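/- Let $C$ be a field of characteristic $0$ and let $K=C(x_1,\dots,x_m)$ be the field of rational functions. Let $\sigma_1,\dots,\sigma_n$ be pairwise commuting $C$-algebra endomorphisms of $K$. For each $i$ let $\delta_i$ be a $\sigma_i$-derivation of $K$, that is, an additive map with $\delta_i(ab)=\sigma_i(a)\delta_i(b)+\delta_i(a)b$; assume that the $\delta_i$ commute pairwise and that $\delta_i$ commutes with $\sigma_j$ for $j\ne i$. Let $\mathbb O=K\langle\partial_1,\dots,\partial_n\rangle$ be the corresponding Ore algebra: the ring generated by $K$ and $\partial_1,\dots,\partial_n$ modulo the relations $\partial_i a=\sigma_i(a)\partial_i+\delta_i(a)$ $(a\in K)$ and $\partial_i\partial_j=\partial_j\partial_i$. Let $\mathbb O^{(s)}$ be the set of left $K$-linear combinations of the monomials $\partial_1^{\alpha_1}\cdots\partial_n^{\alpha_n}$ with $\alpha_1+\dots+\alpha_n\le s$. The Hilbert function of a left ideal $I$ of $\mathbb O$ is $\operatorname{HF}_I(s)=\dim_K\bigl(\mathbb O^{(s)}/(I\cap\mathbb O^{(s)})\bigr)$. The dimension $\dim I$ is the degree of the polynomial that agrees with $\operatorname{HF}_I(s)$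 for all large enough $s$, where the zero polynomial has degree $-\infty$ (so $\dim\mathbb O=-\infty$). For an element $f$ of a left $\mathbb O$-module let $\operatorname{ann}f=\{P\in\mathbb O: P\cdot f=0\}$, a left ideal. A linear extension of $\mathbb O$ with coefficient ring $A$ is given by the following. $A$ is a $K$-algebra with pairwise commuting $C$-algebra endomorphisms $\sigma_i$ and pairwise commuting $\sigma_i$-derivations $\delta_i$ $(1\le i\le n)$, with $\delta_i$ commuting with $\sigma_j$ for $j\neq i$, that extend those of $K$. Moreover $A$ is a left $\mathbb O$-module on which $K$ acts by multiplication and such that $\partial_i\cdot(ab)=\sigma_i(a)(\partial_i\cdot b)+\delta_i(a)b$ for all $a,b\in A$. Finally, for each $i$, both $\sigma_i$ and $\delta_i$, as operators on $A$, are $K$-linear combinations of $\partial_i$ and the identity. **Theorem (Closure Properties).** The dimension of every left ideal of $\mathbb O$ is well defined: for every left ideal $J$ there is a polynomial that agrees with $\operatorname{HF}_J(s)$ for all large enough $s$. Let $I_1,I_2$ be left ideals of $\mathbb O$. 1. Let $f_1,f_2$ be elements of a left $\mathbb O$-module that are annihilated by $I_1$ and $I_2$ respectively. Then $\dim\operatorname{ann}(\partial_i\cdot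 f_1)\le\dim I_1$ for all $i=1,\dots,n$. 2. For the same $f_1,f_2$, $\dim\operatorname{ann}(f_1+f_2)\le\max(\dim I_1,\dim I_2)$. 3. Let $f_1,f_2$ be elements of the coefficient ring of a linear extension of $\mathbb O$ that are annihilated by $I_1$ and $I_2$ respectively. Then $\dim\operatorname{ann}(f_1f_2)\le\dim I_1+\dim I_2$. -/

import Mathlib

open Polynomial

/-- The field `C(x₁, …, x_m)` of rational functions. -/
abbrev RatFunField (C : Type*) [Field C] (m : ℕ) : Type _ :=
  FractionRing (MvPolynomial (Fin m) C)

/-- Data defining an Ore algebra in `n` indeterminates over a coefficient ring `A` (a `C`-algebra):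
commuting `C`-algebra endomorphisms `σ i` and commuting `σ i`-derivations `δ i`, where `δ i`
commutes with `σ j` for `i ≠ j`. -/
structure OreData (C A : Type*) [CommRing C] [Ring A] [Algebra C A] (n : ℕ) where
  σ : Fin n → (A →ₐ[C] A)
  δ : Fin n → (A →+ A)
  δ_mul : ∀ i a b, δ i (a * b) = σ i a * δ i b + δ i a * b
  σ_comm : ∀ i j a, σ i (σ j a) = σ j (σ i a)
  δ_comm : ∀ i j a, δ i (δ j a) = δ j (δ i a)
  σ_δ_comm : ∀ i j, i ≠ j → ∀ a, σ j (δ i a) = δ i (σ j a)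

namespace OreData

section

variable {C A : Type*} [CommRing C] [Ring A] [Algebra C A] {n : ℕ} (D : OreData C A n)

/-- The defining relations of `A⟨∂₁, …, ∂ₙ⟩`, on the free ring generated by the elements of `A` and
the indeterminates: the embedding of `A` is a ring homomorphism, `∂ᵢ a = σᵢ(a) ∂ᵢ + δᵢ(a)`, and
`∂ᵢ ∂ⱼ = ∂ⱼ ∂ᵢ`. -/
inductive Rel : FreeRing (A ⊕ Fin n) → FreeRing (A ⊕ Fin n) → Prop
  | one : Rel (FreeRing.of (Sum.inl 1)) 1
  | add (a b : A) : Rel (FreeRing.of (Sum.inl (a + b)))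
      (FreeRing.of (Sum.inl a) + FreeRing.of (Sum.inl b))
  | mul (a b : A) : Rel (FreeRing.of (Sum.inl (a * b)))
      (FreeRing.of (Sum.inl a) * FreeRing.of (Sum.inl b))
  | ore (i : Fin n) (a : A) : Rel (FreeRing.of (Sum.inr i) * FreeRing.of (Sum.inl a))
      (FreeRing.of (Sum.inl (D.σ i a)) * FreeRing.of (Sum.inr i) +
        FreeRing.of (Sum.inl (D.δ i a)))
  | comm (i j : Fin n) : Rel (FreeRing.of (Sum.inr i) * FreeRing.of (Sum.inr j))
      (FreeRing.of (Sum.inr j) * FreeRing.of (Sum.inr i))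

/-- The Ore algebra `A⟨∂₁, …, ∂ₙ⟩`. -/
def OreAlgebra : Type _ := RingQuot D.Rel

noncomputable instance : Ring D.OreAlgebra := inferInstanceAs (Ring (RingQuot D.Rel))

/-- The canonical map from the free ring on the generators to the Ore algebra. -/
noncomputable def proj : FreeRing (A ⊕ Fin n) →+* D.OreAlgebra := RingQuot.mkRingHom D.Rel

theorem proj_rel {x y : FreeRing (A ⊕ Fin n)} (h : D.Rel x y) : D.proj x = D.proj y :=
  RingQuot.mkRingHom_rel h

/-- The embedding of the coefficients. -/
noncomputable def coeff : A →+* D.OreAlgebra :=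
  RingHom.mk' ⟨⟨fun a => D.proj (FreeRing.of (Sum.inl a)), by simpa using D.proj_rel Rel.one⟩,
    fun a b => by simpa using D.proj_rel (Rel.mul a b)⟩
    (fun a b => by simpa using D.proj_rel (Rel.add a b))

/-- The generators `∂ᵢ`. -/
noncomputable def d (i : Fin n) : D.OreAlgebra := D.proj (FreeRing.of (Sum.inr i))

theorem d_mul_coeff (i : Fin n) (a : A) :
    D.d i * D.coeff a = D.coeff (D.σ i a) * D.d i + D.coeff (D.δ i a) := by
  have h := D.proj_rel (Rel.ore i a)
  rw [map_mul, map_add, map_mul] at h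
  exact h

theorem d_comm (i j : Fin n) : Commute (D.d i) (D.d j) := by
  have h := D.proj_rel (Rel.comm i j)
  rw [map_mul, map_mul] at h
  exact h

/-- The Ore algebra is a left module over its coefficient ring, through left multiplication. -/
noncomputable instance : Module A D.OreAlgebra := Module.compHom D.OreAlgebra D.coeff

instance : IsScalarTower A D.OreAlgebra D.OreAlgebra :=
  ⟨fun a x y => mul_assoc (D.coeff a) x y⟩

/-- The monomial `∂^α = ∂₁^α₁ ⋯ ∂ₙ^αₙ`. -/
noncomputable def monomial (α : Fin n → ℕ) : D.OreAlgebra :=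
  Finset.univ.noncommProd (fun i => D.d i ^ α i) (fun i _ j _ _ => (D.d_comm i j).pow_pow _ _)

/-- The operators of total degree at most `s`: the left combinations, with coefficients in `A`, of
the monomials `∂^α` with `|α| ≤ s`. -/
noncomputable def degreeLE (s : ℕ) : Submodule A D.OreAlgebra :=
  Submodule.span A {P | ∃ α : Fin n → ℕ, ∑ i, α i ≤ s ∧ P = D.monomial α}

end

section

variable {C K : Type*} [Field C] [Field K] [Algebra C K] {n : ℕ} (D : OreData C K n)

/-- The Hilbert function `s ↦ dim_K (R^(s) / (I ∩ R^(s)))` of a left ideal `I` of `R = K⟨∂⟩`.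
(`Ideal` means left ideal.) -/
noncomputable def hilbertFunction (I : Ideal D.OreAlgebra) (s : ℕ) : ℕ :=
  Module.finrank K
    (D.degreeLE s ⧸ (I.restrictScalars K).comap (D.degreeLE s).subtype)

/-- `P` agrees with the Hilbert function of `I` at all large enough integers. -/
def IsHilbertPolynomial (I : Ideal D.OreAlgebra) (P : ℚ[X]) : Prop :=
  ∀ᶠ s : ℕ in Filter.atTop, (D.hilbertFunction I s : ℚ) = P.eval (s : ℚ)

open Classical in
/-- The (Hilbert) dimension of a left ideal: the degree of its Hilbert polynomial. It is `⊥`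
(that is, `-∞`) if the Hilbert polynomial is zero, that is, for the unit ideal. -/
noncomputable def dim (I : Ideal D.OreAlgebra) : WithBot ℕ :=
  if h : ∃ P, D.IsHilbertPolynomial I P then h.choose.degree else ⊥

theorem IsHilbertPolynomial.unique {D : OreData C K n} {I : Ideal D.OreAlgebra} {P Q : ℚ[X]}
    (hP : D.IsHilbertPolynomial I P) (hQ : D.IsHilbertPolynomial I Q) : P = Q := by
  obtain ⟨N, hN⟩ := Filter.eventually_atTop.1 (hP.and hQ)
  apply Polynomial.eq_of_infinite_eval_eq
  refine ((Set.Ici_infinite N).image (Nat.cast_injective (R := ℚ)).injOn).mono ?_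
  rintro _ ⟨s, hs, rfl⟩
  exact ((hN s hs).1.symm.trans (hN s hs).2)

theorem IsHilbertPolynomial.dim_eq {D : OreData C K n} {I : Ideal D.OreAlgebra} {P : ℚ[X]}
    (hP : D.IsHilbertPolynomial I P) : D.dim I = P.degree := by
  have h : ∃ P, D.IsHilbertPolynomial I P := ⟨P, hP⟩
  rw [dim, dif_pos h, h.choose_spec.unique hP]

/-- `E` is a linear extension of `D`, with coefficient ring the `K`-algebra `A`, on which the
operators of `K⟨∂⟩` act: the `σᵢ` and `δᵢ` of `E` extend those of `D`, the elements of `K` act on `A`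
by multiplication, `∂ᵢ` acts compatibly with the commutation rule of `A⟨∂⟩ = A ⊗_K K⟨∂⟩` (that is,
`A` is a left `A⟨∂⟩`-module in which `A` acts by left multiplication), and, as operators on `A`, both
`σᵢ` and `δᵢ` are `K`-linear combinations of `∂ᵢ` and the identity. -/
structure IsLinearExtension {A : Type*} [Ring A] [Algebra C A] [Algebra K A]
    (E : OreData C A n) [Module D.OreAlgebra A] : Prop where
  σ_algebraMap : ∀ i (c : K), E.σ i (algebraMap K A c) = algebraMap K A (D.σ i c)
  δ_algebraMap : ∀ i (c : K), E.δ i (algebraMap K A c) = algebraMap K A (D.δ i c)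
  coeff_smul : ∀ (c : K) (a : A), D.coeff c • a = algebraMap K A c * a
  d_smul_mul : ∀ i (a b : A), D.d i • (a * b) = E.σ i a * (D.d i • b) + E.δ i a * b
  linear_σ : ∀ i, ∃ u v : K, ∀ a : A, E.σ i a = u • (D.d i • a) + v • a
  linear_δ : ∀ i, ∃ u v : K, ∀ a : A, E.δ i a = u • (D.d i • a) + v • a

end

end OreData

/-! The existence of Hilbert polynomials is Macaulay's counting argument. Order the monomials by
`DegLex` and call one standard modulo `I` if its class is not a `K`-combination of the classes of
smaller monomials. Standard monomials of degree at most `s` give a basis of the image of `degreeLE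
s` in the quotient, so the Hilbert function counts them (`hilbertFunction_eq_countCompl`). The
nonstandard exponents form an upper set of `ℕⁿ`, and the complement of an upper set has eventually
polynomial counting function, by Dickson's lemma and induction on `n`. The argument uses only that
the monomials span, not that they are independent in the Ore algebra.

For the closure properties, the Hilbert function of `ann f` at `s` is the dimension of the space
`orbitLE f s`, and it is at most that of any ideal annihilating `f`. The orbit of `∂ᵢ f₁` lies in
that of `f₁` with `s` shifted by one, the orbit of a sum in the sum of the orbits, and the orbit of
a product in the product of the orbits. Comparing dimensions for large `s` bounds the degrees. -/

/-! ### Eventually polynomial sequences. -/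

/-- `f` agrees with a polynomial at all large enough integers. -/
def IsEventuallyPolynomial (f : ℕ → ℕ) : Prop :=
  ∃ P : ℚ[X], ∀ᶠ s : ℕ in Filter.atTop, (f s : ℚ) = P.eval (s : ℚ)

namespace IsEventuallyPolynomial

theorem const (c : ℕ) : IsEventuallyPolynomial fun _ => c :=
  ⟨C (c : ℚ), by simp⟩

theorem add {f g : ℕ → ℕ} (hf : IsEventuallyPolynomial f) (hg : IsEventuallyPolynomial g) :
    IsEventuallyPolynomial fun s => f s + g s := by
  obtain ⟨P, hP⟩ := hf
  obtain ⟨Q, hQ⟩ := hg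
  refine ⟨P + Q, ?_⟩
  filter_upwards [hP, hQ] with s h₁ h₂
  simp [h₁, h₂]

theorem sum {ι : Type*} (t : Finset ι) {f : ι → ℕ → ℕ}
    (hf : ∀ i ∈ t, IsEventuallyPolynomial (f i)) :
    IsEventuallyPolynomial fun s => ∑ i ∈ t, f i s := by
  classical
  induction t using Finset.induction_on with
  | empty => simpa using const 0
  | insert a t ha ih =>
    simp only [Finset.sum_insert ha]
    exact (hf a (by simp)).add (ih fun i hi => hf i (by simp [hi]))

theorem comp_sub {f : ℕ → ℕ} (hf : IsEventuallyPolynomial f) (k : ℕ) :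
    IsEventuallyPolynomial fun s => f (s - k) := by
  obtain ⟨P, hP⟩ := hf
  -- This is `P(X - k)`; the truncated subtraction `s - k` is exact once `k ≤ s`.
  refine ⟨taylor (-(k : ℚ)) P, ?_⟩
  filter_upwards [(Filter.tendsto_sub_atTop_nat k).eventually hP, Filter.eventually_ge_atTop k]
    with s hs hk
  rw [hs, taylor_eval, Nat.cast_sub hk, sub_eq_add_neg]

theorem congr {f g : ℕ → ℕ} (hf : IsEventuallyPolynomial f)
    (h : ∀ᶠ s in Filter.atTop, g s = f s) : IsEventuallyPolynomial g := by
  obtain ⟨P, hP⟩ := hf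
  refine ⟨P, ?_⟩
  filter_upwards [hP, h] with s h₁ h₂
  rw [h₂, h₁]

end IsEventuallyPolynomial

/-- The partial sums of a polynomial form a polynomial. -/
theorem Polynomial.exists_eval_eq_sum_range (P : ℚ[X]) :
    ∃ Q : ℚ[X], ∀ s : ℕ, Q.eval (s : ℚ) = ∑ k ∈ Finset.range s, P.eval (k : ℚ) := by
  induction P using Polynomial.induction_on' with
  | add P Q hP hQ =>
    obtain ⟨P', hP⟩ := hP
    obtain ⟨Q', hQ⟩ := hQ
    exact ⟨P' + Q', fun s => by simp [hP, hQ, Finset.sum_add_distrib]⟩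
  | monomial p a =>
    -- Faulhaber's formula for the sum of `p`-th powers, with Bernoulli numbers.
    refine ⟨∑ i ∈ Finset.range (p + 1),
      Polynomial.monomial (p + 1 - i) (a * (_root_.bernoulli i * ((p + 1).choose i : ℚ) / (p + 1))),
      fun s => ?_⟩
    simp only [eval_monomial, ← Finset.mul_sum, sum_range_pow, eval_finsetSum]
    rw [Finset.mul_sum]
    refine Finset.sum_congr rfl fun i _ => ?_
    ring

theorem IsEventuallyPolynomial.sum_range {f : ℕ → ℕ} (hf : IsEventuallyPolynomial f) :
    IsEventuallyPolynomial fun s => ∑ k ∈ Finset.range (s + 1), f k := by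
  obtain ⟨P, hP⟩ := hf
  obtain ⟨N, hN⟩ := Filter.eventually_atTop.1 hP
  obtain ⟨Q, hQ⟩ := P.exists_eval_eq_sum_range
  -- `taylor 1 Q` is `Q(X + 1)`, since the sum includes `k = s`; the constant corrects for the
  -- finitely many `k < N` where `f` and `P` may differ.
  refine ⟨taylor 1 Q + C (∑ k ∈ Finset.range N, ((f k : ℚ) - P.eval (k : ℚ))), ?_⟩
  filter_upwards [Filter.eventually_ge_atTop N] with s hs
  have h : ∑ k ∈ Finset.range N, ((f k : ℚ) - P.eval (k : ℚ)) =
      ∑ k ∈ Finset.range (s + 1), ((f k : ℚ) - P.eval (k : ℚ)) := by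
    refine Finset.sum_subset (Finset.range_subset_range.2 (by omega)) fun k _ hk => ?_
    rw [hN k (by simpa using hk), sub_self]
  have h' := hQ (s + 1)
  push_cast at h'
  rw [eval_add, taylor_eval, eval_C, h, h', Finset.sum_sub_distrib]
  push_cast
  ring

/-! ### Counting the exponents outside an upper set. -/

/-- An increasing sequence of upper sets of a well-quasi-order is eventually constant. -/
theorem exists_forall_ge_eq_of_isUpperSet {α : Type*} [PartialOrder α] [WellQuasiOrderedLE α]
    {L : ℕ → Set α} (hL : ∀ k, IsUpperSet (L k)) (hm : Monotone L) :
    ∃ N, ∀ k, N ≤ k → L k = L N := by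
  classical
  -- The union is generated by its finitely many minimal elements, so it is exhausted as soon as all
  -- of them have appeared.
  have hfin : {x | Minimal (· ∈ ⋃ k, L k) x}.Finite :=
    WellQuasiOrderedLE.finite_of_isAntichain (setOfPred_minimal_antichain _)
  have hex : ∀ x : α, ∃ k, x ∈ ⋃ k, L k → x ∈ L k := fun x => by
    by_cases hx : x ∈ ⋃ k, L k
    · obtain ⟨k, hk⟩ := Set.mem_iUnion.1 hx
      exact ⟨k, fun _ => hk⟩
    · exact ⟨0, fun h => absurd h hx⟩
  choose κ hκ using hex
  refine ⟨hfin.toFinset.sup κ, fun k hk => (hm hk).antisymm' fun y hy => ?_⟩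
  obtain ⟨x, hxy, hx⟩ := exists_minimal_le_of_wellFoundedLT (· ∈ ⋃ k, L k) y
    (Set.mem_iUnion.2 ⟨k, hy⟩)
  exact hL _ hxy (hm (Finset.le_sup (f := κ) (hfin.mem_toFinset.2 hx)) (hκ x hx.prop))

open Classical in
/-- The number of exponent vectors of degree at most `s` outside `L`. -/
noncomputable def countCompl {n : ℕ} (L : Set (Fin n → ℕ)) (s : ℕ) : ℕ :=
  ((Finset.Iic fun _ => s).filter fun α : Fin n → ℕ => ∑ i, α i ≤ s ∧ α ∉ L).card

theorem mem_filter_sum_le {n s : ℕ} {p : (Fin n → ℕ) → Prop} [DecidablePred p] {α : Fin n → ℕ} :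
    α ∈ (Finset.Iic fun _ => s).filter (fun α : Fin n → ℕ => ∑ i, α i ≤ s ∧ p α) ↔
      ∑ i, α i ≤ s ∧ p α := by
  simp only [Finset.mem_filter, Finset.mem_Iic, and_iff_right_iff_imp]
  exact fun h i => (Finset.single_le_sum (fun _ _ => Nat.zero_le _) (Finset.mem_univ i)).trans h.1

/-- Slicing by the first coordinate `k`, which leaves degree `s - k` to the others, makes induction
on `n` possible. -/
theorem countCompl_succ {n : ℕ} (L : Set (Fin (n + 1) → ℕ)) (s : ℕ) :
    countCompl L s =
      ∑ k ∈ Finset.range (s + 1), countCompl {β : Fin n → ℕ | Fin.cons k β ∈ L} (s - k) := by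
  classical
  rw [countCompl, Finset.card_eq_sum_card_fiberwise (f := fun α => α 0)
    (t := Finset.range (s + 1))]
  · refine Finset.sum_congr rfl fun k hk => ?_
    rw [countCompl]
    refine Finset.card_nbij' (fun α => Fin.tail α) (fun β => Fin.cons k β) ?_ ?_ ?_ ?_
    · intro α hα
      obtain ⟨hα', rfl⟩ := Finset.mem_filter.1 (Finset.mem_coe.1 hα)
      rw [mem_filter_sum_le, Fin.sum_univ_succ] at hα'
      rw [Finset.mem_coe]
      refine mem_filter_sum_le.2 ⟨?_, ?_⟩
      · change ∑ i : Fin n, α i.succ ≤ _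
        omega
      · simpa using hα'.2
    · intro β hβ
      have hβ := mem_filter_sum_le.1 hβ
      rw [Finset.mem_range] at hk
      refine Finset.mem_filter.2 ⟨mem_filter_sum_le.2 ⟨?_, hβ.2⟩, by simp⟩
      rw [Fin.sum_univ_succ]
      simp only [Fin.cons_zero, Fin.cons_succ]
      omega
    · intro α hα
      obtain ⟨-, rfl⟩ := Finset.mem_filter.1 hα
      simp
    · intro β _
      simp
  · intro α hα
    have h := (mem_filter_sum_le.1 hα).1
    rw [Fin.sum_univ_succ] at h
    simp only [Finset.coe_range, Set.mem_Iio]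
    omega

/-- The number of exponent vectors of degree at most `s` outside an upper set is eventually
polynomial in `s`. -/
theorem IsUpperSet.isEventuallyPolynomial_countCompl {n : ℕ} {L : Set (Fin n → ℕ)}
    (hL : IsUpperSet L) : IsEventuallyPolynomial (countCompl L) := by
  induction n with
  | zero =>
    refine (IsEventuallyPolynomial.const (countCompl L 0)).congr (.of_forall fun s => ?_)
    simp only [countCompl]
    congr 1
    ext α
    simp [Finset.mem_filter, Subsingleton.elim α fun _ => 0]
  | succ n ih =>
    let S : ℕ → Set (Fin n → ℕ) := fun k => {β | Fin.cons k β ∈ L}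
    have hS : ∀ k, IsUpperSet (S k) := fun k β γ h hβ =>
      hL (Fin.cons_le_cons.2 ⟨le_rfl, h⟩) hβ
    have hm : Monotone S := fun k l h β hβ => hL (Fin.cons_le_cons.2 ⟨h, le_rfl⟩) hβ
    obtain ⟨N, hN⟩ := exists_forall_ge_eq_of_isUpperSet hS hm
    -- The slices `k < N` contribute finitely many shifted sequences. From `N` on every slice equals
    -- `S N`, and the contributions, in reversed order, form a partial sum of `countCompl (S N)` up
    -- to `s - N`.
    refine ((IsEventuallyPolynomial.sum (Finset.range N) fun k _ => (ih (hS k)).comp_sub k).add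
      ((ih (hS N)).sum_range.comp_sub N)).congr ?_
    filter_upwards [Filter.eventually_ge_atTop N] with s hs
    obtain ⟨t, rfl⟩ := Nat.exists_eq_add_of_le hs
    rw [countCompl_succ, add_assoc, Finset.sum_range_add, Nat.add_sub_cancel_left,
      ← Finset.sum_range_reflect (countCompl (S N)) (t + 1)]
    congr 1
    refine Finset.sum_congr rfl fun j _ => ?_
    rw [show {β : Fin n → ℕ | Fin.cons (N + j) β ∈ L} = S N from hN _ (Nat.le_add_right _ _)]
    congr 1
    omega

/-! ### Standard vectors, and degrees compared through values. -/

/-- A vector of a family indexed by a linear order is standard if it is not a combination of the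
preceding ones. The standard vectors of a finite initial segment form a basis of its span. -/
theorem linearIndepOn_standard {K V ι : Type*} [Field K] [AddCommGroup V] [Module K V]
    [LinearOrder ι] (v : ι → V) (T : Finset ι) (hT : IsLowerSet (T : Set ι)) :
    LinearIndepOn K v {x | x ∈ T ∧ v x ∉ Submodule.span K (v '' Set.Iio x)} ∧
      Submodule.span K (v '' {x | x ∈ T ∧ v x ∉ Submodule.span K (v '' Set.Iio x)}) =
        Submodule.span K (v '' T) := by
  classical
  induction T using Finset.induction_on_max with
  | empty => simp
  | insert a T ha ih =>
    -- As the segment is initial, everything below its maximum `a` is in `T`; being standard at `a`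
    -- thus means lying outside the span already built.
    have hIio : Set.Iio a = (T : Set ι) := by
      ext x
      refine ⟨fun hx => ?_, fun hx => ha x hx⟩
      have := hT (le_of_lt hx) (by simp)
      simpa [(show x < a from hx).ne] using this
    have hlow : IsLowerSet (T : Set ι) := hIio ▸ isLowerSet_Iio a
    obtain ⟨h₁, h₂⟩ := ih hlow
    by_cases hv : v a ∈ Submodule.span K (v '' Set.Iio a)
    · have hset : {x | x ∈ insert a T ∧ v x ∉ Submodule.span K (v '' Set.Iio x)} =
          {x | x ∈ T ∧ v x ∉ Submodule.span K (v '' Set.Iio x)} := by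
        ext x
        simp only [Finset.mem_insert, Set.mem_ofPred_eq]
        grind
      rw [hset]
      refine ⟨h₁, ?_⟩
      rw [hIio] at hv
      rw [h₂, Finset.coe_insert, Set.image_insert_eq, Submodule.span_insert_eq_span hv]
    · have hset : {x | x ∈ insert a T ∧ v x ∉ Submodule.span K (v '' Set.Iio x)} =
          insert a {x | x ∈ T ∧ v x ∉ Submodule.span K (v '' Set.Iio x)} := by
        ext x
        simp only [Finset.mem_insert, Set.mem_ofPred_eq, Set.mem_insert_iff]
        grind
      rw [hset]
      refine ⟨h₁.insert ?_, ?_⟩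
      · rwa [h₂, ← hIio]
      · rw [Finset.coe_insert, Set.image_insert_eq, Set.image_insert_eq, Submodule.span_insert,
          Submodule.span_insert, h₂]

/-- Comparison of degrees from a comparison of values at large integers. -/
theorem Polynomial.degree_le_of_eventually_le {P Q : ℚ[X]}
    (h₀ : ∀ᶠ s : ℕ in Filter.atTop, 0 ≤ P.eval (s : ℚ))
    (h : ∀ᶠ s : ℕ in Filter.atTop, P.eval (s : ℚ) ≤ Q.eval (s : ℚ)) : P.degree ≤ Q.degree := by
  -- If `Q` had smaller degree, then `Q / P` would tend to `0`; as `P` is eventually positive, `Q <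
  -- P` would follow.
  by_contra! hlt
  have hP : P ≠ 0 := by
    rintro rfl
    simp at hlt
  have hroot : ∀ᶠ s : ℕ in Filter.atTop, P.eval (s : ℚ) ≠ 0 :=
    tendsto_natCast_atTop_atTop.eventually (P.eventually_atTop_not_isRoot hP)
  have hlim := (Polynomial.div_tendsto_atTop_zero_of_degree_lt Q P hlt).comp
    (tendsto_natCast_atTop_atTop (R := ℚ))
  obtain ⟨s, hs⟩ := ((hlim.eventually_lt_const one_pos).and (hroot.and (h.and h₀))).exists
  obtain ⟨h₁, h₂, h₃, h₄⟩ := hs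
  simp only [Function.comp_apply] at h₁
  rw [div_lt_one (lt_of_le_of_ne h₄ (Ne.symm h₂))] at h₁
  exact absurd h₃ (not_le.2 h₁)

/-! ### The Hilbert function as a count of standard monomials. -/

namespace OreData

section

variable {C K : Type*} [Field C] [Field K] [Algebra C K] {n : ℕ} (D : OreData C K n)

theorem smul_eq_coeff_mul (c : K) (x : D.OreAlgebra) : c • x = D.coeff c * x := rfl

theorem monomial_zero : D.monomial 0 = 1 := by
  rw [show (1 : D.OreAlgebra) = 1 ^ (Finset.univ : Finset (Fin n)).card from (one_pow _).symm]
  exact Finset.noncommProd_eq_pow_card _ _ _ _ fun i _ => pow_zero _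

theorem d_mul_monomial (i : Fin n) (α : Fin n → ℕ) :
    D.d i * D.monomial α = D.monomial (Pi.single i 1 + α) := by
  have h : ∀ β, D.monomial β = D.d i ^ β i * (Finset.univ.erase i).noncommProd
      (fun j => D.d j ^ β j) (fun j _ k _ _ => (D.d_comm j k).pow_pow _ _) := fun β =>
    (Finset.mul_noncommProd_erase _ (Finset.mem_univ i) _ _).symm
  rw [h, h (Pi.single i 1 + α), ← mul_assoc, ← pow_succ']
  congr 1
  · simp [add_comm]
  · refine Finset.noncommProd_congr rfl (fun j hj => ?_) _
    simp [Finset.ne_of_mem_erase hj]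

theorem monomial_mul_d (i : Fin n) (α : Fin n → ℕ) :
    D.monomial α * D.d i = D.monomial (Pi.single i 1 + α) := by
  rw [← d_mul_monomial]
  exact ((Finset.noncommProd_commute _ _ _ _ fun j _ => (D.d_comm i j).pow_right _)).symm.eq

theorem finite_sum_le (n s : ℕ) : {α : Fin n → ℕ | ∑ i, α i ≤ s}.Finite :=
  (Set.finite_Iic fun _ : Fin n => s).subset fun _ hα i =>
    (Finset.single_le_sum (fun _ _ => Nat.zero_le _) (Finset.mem_univ i)).trans hα

theorem degreeLE_eq_span_image (s : ℕ) :
    D.degreeLE s = Submodule.span K (D.monomial '' {α | ∑ i, α i ≤ s}) := by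
  rw [degreeLE]
  congr 1
  ext P
  simp only [Set.mem_image, Set.mem_ofPred_eq, eq_comm]

/-- Finiteness keeps `finrank` away from its default value `0`, so that dimensions are monotone
under inclusion. -/
instance (s : ℕ) : Module.Finite K (D.degreeLE s) := by
  rw [degreeLE_eq_span_image]
  exact .span_of_finite K ((finite_sum_le n s).image _)

theorem degreeLE_mono {s t : ℕ} (h : s ≤ t) : D.degreeLE s ≤ D.degreeLE t :=
  Submodule.span_mono fun _ ⟨α, hα, hP⟩ => ⟨α, hα.trans h, hP⟩

theorem sum_single_add (i : Fin n) (α : Fin n → ℕ) :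
    ∑ j, (Pi.single i 1 + α : Fin n → ℕ) j = ∑ j, α j + 1 := by
  simp [Finset.sum_add_distrib, add_comm]

/-- Left multiplication by `∂ᵢ` raises the degree by at most one. -/
theorem d_mul_mem_degreeLE (i : Fin n) {s : ℕ} {P : D.OreAlgebra} (hP : P ∈ D.degreeLE s) :
    D.d i * P ∈ D.degreeLE (s + 1) := by
  induction hP using Submodule.span_induction with
  | mem P h =>
    obtain ⟨α, hα, rfl⟩ := h
    exact Submodule.subset_span
      ⟨_, (sum_single_add i α).trans_le (Nat.add_le_add_right hα 1), D.d_mul_monomial i α⟩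
  | zero => simp
  | add P Q _ _ hP hQ => exact mul_add (D.d i) P Q ▸ add_mem hP hQ
  | smul c P hP' hP =>
    rw [smul_eq_coeff_mul, ← mul_assoc, d_mul_coeff, add_mul, mul_assoc]
    exact add_mem (Submodule.smul_mem _ (D.σ i c) hP)
      (Submodule.smul_mem _ (D.δ i c) (D.degreeLE_mono (Nat.le_succ s) hP'))

/-- Right multiplication by `∂ᵢ` raises the degree by at most one. -/
theorem mul_d_mem_degreeLE (i : Fin n) {s : ℕ} {P : D.OreAlgebra} (hP : P ∈ D.degreeLE s) :
    P * D.d i ∈ D.degreeLE (s + 1) := by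
  induction hP using Submodule.span_induction with
  | mem P h =>
    obtain ⟨α, hα, rfl⟩ := h
    exact Submodule.subset_span
      ⟨_, (sum_single_add i α).trans_le (Nat.add_le_add_right hα 1), D.monomial_mul_d i α⟩
  | zero => simp
  | add P Q _ _ hP hQ => exact add_mul P Q (D.d i) ▸ add_mem hP hQ
  | smul c P _ hP => exact smul_mul_assoc c P (D.d i) ▸ Submodule.smul_mem _ c hP

/-- The class of `∂^α` modulo `I`, for the exponent vector `α` in the graded lexicographic order. -/
noncomputable def monomialClass (I : Ideal D.OreAlgebra) (a : DegLex (Fin n →₀ ℕ)) :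
    D.OreAlgebra ⧸ I :=
  Submodule.Quotient.mk (D.monomial (ofDegLex a : Fin n →₀ ℕ))

/-- The exponents of the monomials that are, modulo `I`, combinations of smaller monomials. -/
def leadingExponents (I : Ideal D.OreAlgebra) : Set (Fin n → ℕ) :=
  {α | D.monomialClass I (toDegLex (Finsupp.equivFunOnFinite.symm α)) ∈
    Submodule.span K (D.monomialClass I ''
      Set.Iio (toDegLex (Finsupp.equivFunOnFinite.symm α)))}

theorem coe_mem_leadingExponents (I : Ideal D.OreAlgebra) {a : Fin n →₀ ℕ} :
    (a : Fin n → ℕ) ∈ D.leadingExponents I ↔ D.monomialClass I (toDegLex a) ∈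
      Submodule.span K (D.monomialClass I '' Set.Iio (toDegLex a)) := by
  simp [leadingExponents]

theorem monomialClass_single_add (I : Ideal D.OreAlgebra) (i : Fin n) (a : DegLex (Fin n →₀ ℕ)) :
    D.monomialClass I (toDegLex (Finsupp.single i 1) + a) = D.d i • D.monomialClass I a := by
  rw [monomialClass, monomialClass, ← Submodule.Quotient.mk_smul, smul_eq_mul, d_mul_monomial]
  congr 2
  ext j
  change (Finsupp.single i 1 + ofDegLex a : Fin n →₀ ℕ) j = _
  simp [Finsupp.single_apply, Pi.single_apply, eq_comm]

/-- Applying `∂ᵢ` to a combination of smaller monomials shifts all exponents compatibly with the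
order and replaces coefficients `c` by `σᵢ c`. The extra terms with `δᵢ c` keep the old exponents,
which are smaller still. -/
theorem isUpperSet_leadingExponents (I : Ideal D.OreAlgebra) :
    IsUpperSet (D.leadingExponents I) := by
  have hstep : ∀ (i : Fin n) (a : DegLex (Fin n →₀ ℕ)),
      D.monomialClass I a ∈ Submodule.span K (D.monomialClass I '' Set.Iio a) →
      D.monomialClass I (toDegLex (Finsupp.single i 1) + a) ∈ Submodule.span K
        (D.monomialClass I '' Set.Iio (toDegLex (Finsupp.single i 1) + a)) := by
    intro i a ha
    have hle : a ≤ toDegLex (Finsupp.single i 1) + a :=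
      le_add_of_nonneg_left bot_le
    rw [monomialClass_single_add]
    generalize D.monomialClass I a = y at ha
    induction ha using Submodule.span_induction with
    | mem x hx =>
      obtain ⟨b, hb, rfl⟩ := hx
      rw [← monomialClass_single_add]
      exact Submodule.subset_span ⟨_, Set.mem_Iio.2 (add_lt_add_right (Set.mem_Iio.1 hb) _), rfl⟩
    | zero => simp
    | add x y _ _ hx hy => exact smul_add (D.d i) x y ▸ add_mem hx hy
    | smul c x hx' hx =>
      have h : D.d i • c • x = D.σ i c • D.d i • x + D.δ i c • x := by
        obtain ⟨P, rfl⟩ := Submodule.Quotient.mk_surjective _ x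
        simp only [← Submodule.Quotient.mk_smul, ← Submodule.Quotient.mk_add]
        congr 1
        simp only [smul_eq_mul, smul_eq_coeff_mul]
        rw [← mul_assoc, d_mul_coeff, add_mul, mul_assoc]
      rw [h]
      exact add_mem (Submodule.smul_mem _ _ hx) (Submodule.smul_mem _ _
        (Submodule.span_mono (Set.image_mono (Set.Iio_subset_Iio hle)) hx'))
  have hadd : ∀ b a : Fin n →₀ ℕ, (a : Fin n → ℕ) ∈ D.leadingExponents I →
      ((b + a : Fin n →₀ ℕ) : Fin n → ℕ) ∈ D.leadingExponents I := by
    intro b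
    induction b using Finsupp.induction_linear with
    | zero => simp
    | add f g hf hg => exact fun a ha => add_assoc f g a ▸ hf _ (hg a ha)
    | single i k =>
      induction k with
      | zero => simp
      | succ k ih =>
        intro a ha
        rw [add_comm k 1, Finsupp.single_add, add_assoc]
        exact (D.coe_mem_leadingExponents I).2
          (hstep i _ ((D.coe_mem_leadingExponents I).1 (ih a ha)))
  intro α β h hα
  obtain ⟨γ, rfl⟩ := exists_add_of_le h
  rw [add_comm]
  exact hadd (Finsupp.equivFunOnFinite.symm γ) (Finsupp.equivFunOnFinite.symm α) hα

/-- The value of the Hilbert function of the kernel of a linear map is the dimension of the image of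
the operators of bounded degree. -/
theorem hilbertFunction_eq_finrank_map {V : Type*} [AddCommGroup V] [Module K V]
    (I : Ideal D.OreAlgebra) (f : D.OreAlgebra →ₗ[K] V)
    (hf : LinearMap.ker f = I.restrictScalars K) (s : ℕ) :
    D.hilbertFunction I s = Module.finrank K ((D.degreeLE s).map f) := by
  have h : (I.restrictScalars K).comap (D.degreeLE s).subtype =
      LinearMap.ker (f ∘ₗ (D.degreeLE s).subtype) := by
    rw [LinearMap.ker_comp, hf]
  rw [hilbertFunction, h, (LinearMap.quotKerEquivRange _).finrank_eq, LinearMap.range_comp,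
    Submodule.range_subtype]

/-- The order must be graded here: then the exponents of degree at most `s` form an initial segment,
and `linearIndepOn_standard` applies to it. -/
theorem hilbertFunction_eq_countCompl (I : Ideal D.OreAlgebra) (s : ℕ) :
    D.hilbertFunction I s = countCompl (D.leadingExponents I) s := by
  classical
  let e : (Fin n → ℕ) ≃ DegLex (Fin n →₀ ℕ) := Finsupp.equivFunOnFinite.symm.trans toDegLex
  have hdeg : ∀ α, (ofDegLex (e α)).degree = ∑ i, α i := fun α => by
    simp [e, Finsupp.degree_eq_sum]
  let T : Finset (DegLex (Fin n →₀ ℕ)) := (finite_sum_le n s).toFinset.map e.toEmbedding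
  have hT : (T : Set (DegLex (Fin n →₀ ℕ))) = e '' {α | ∑ i, α i ≤ s} := by simp [T]
  have hmem : ∀ α, e α ∈ T ↔ ∑ i, α i ≤ s := fun α => by simp [T]
  have hlow : IsLowerSet (T : Set (DegLex (Fin n →₀ ℕ))) := by
    intro a b hba ha
    obtain ⟨α, rfl⟩ := e.surjective a
    obtain ⟨β, rfl⟩ := e.surjective b
    simp only [Finset.mem_coe, hmem] at ha ⊢
    have := Finsupp.DegLex.monotone_degree hba
    simp only [hdeg] at this
    exact this.trans ha
  obtain ⟨h₁, h₂⟩ := linearIndepOn_standard (K := K) (D.monomialClass I) T hlow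
  have hS : {x | x ∈ T ∧ D.monomialClass I x ∉
      Submodule.span K (D.monomialClass I '' Set.Iio x)} =
      e '' ((Finset.Iic fun _ => s).filter
        fun α : Fin n → ℕ => ∑ i, α i ≤ s ∧ α ∉ D.leadingExponents I :) := by
    ext x
    obtain ⟨α, rfl⟩ := e.surjective x
    rw [e.injective.mem_set_image, Finset.mem_coe, mem_filter_sum_le, ← hmem]
    rfl
  let f : D.OreAlgebra →ₗ[K] D.OreAlgebra ⧸ I := (I.mkQ).restrictScalars K
  have hf : LinearMap.ker f = I.restrictScalars K := by
    rw [LinearMap.ker_restrictScalars, Submodule.ker_mkQ]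
  have himage : f '' (D.monomial '' {α | ∑ i, α i ≤ s}) = D.monomialClass I '' T := by
    rw [hT, ← Set.image_comp, ← Set.image_comp]
    rfl
  rw [D.hilbertFunction_eq_finrank_map I f hf, degreeLE_eq_span_image, Submodule.map_span, himage,
    ← h₂, hS, Set.image_eq_range]
  rw [hS] at h₁
  rw [finrank_span_eq_card h₁, ← Nat.card_eq_fintype_card,
    Nat.card_image_of_injective e.injective, Nat.card_eq_card_toFinset, Finset.toFinset_coe]
  rfl

theorem exists_isHilbertPolynomial (I : Ideal D.OreAlgebra) :
    ∃ P : ℚ[X], D.IsHilbertPolynomial I P := by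
  have h := (D.isUpperSet_leadingExponents I).isEventuallyPolynomial_countCompl
  rwa [show countCompl (D.leadingExponents I) = D.hilbertFunction I from
    (funext (D.hilbertFunction_eq_countCompl I)).symm] at h

end

/-! ### Orbits, and the bounds for `∂ᵢ f₁` and `f₁ + f₂`. -/

section

variable {C K : Type*} [Field C] [Field K] [Algebra C K] {n : ℕ} {D : OreData C K n}

theorem IsHilbertPolynomial.dim_le {I : Ideal D.OreAlgebra} {Q : ℚ[X]}
    (h : ∀ᶠ s : ℕ in Filter.atTop, (D.hilbertFunction I s : ℚ) ≤ Q.eval (s : ℚ)) :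
    D.dim I ≤ Q.degree := by
  obtain ⟨P, hP⟩ := D.exists_isHilbertPolynomial I
  rw [hP.dim_eq]
  refine Polynomial.degree_le_of_eventually_le ?_ ?_
  · filter_upwards [hP] with s hs
    exact hs ▸ Nat.cast_nonneg _
  · filter_upwards [hP, h] with s hs hs'
    exact hs ▸ hs'

variable {V : Type*} [AddCommGroup V] [Module K V] [Module D.OreAlgebra V]
  [IsScalarTower K D.OreAlgebra V]

variable (D) in
/-- The space of the results of the operators of degree at most `s` on `f`. -/
noncomputable def orbitLE (f : V) (s : ℕ) : Submodule K V :=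
  (D.degreeLE s).map ((LinearMap.toSpanSingleton D.OreAlgebra V f).restrictScalars K)

theorem mem_orbitLE {f g : V} {s : ℕ} :
    g ∈ D.orbitLE f s ↔ ∃ P ∈ D.degreeLE s, P • f = g := by
  simp [orbitLE]

instance (f : V) (s : ℕ) : Module.Finite K (D.orbitLE f s) :=
  inferInstanceAs (Module.Finite K ((D.degreeLE s).map _))

theorem orbitLE_mono (f : V) {s t : ℕ} (h : s ≤ t) : D.orbitLE f s ≤ D.orbitLE f t :=
  Submodule.map_mono (D.degreeLE_mono h)

theorem d_smul_mem_orbitLE (i : Fin n) {f g : V} {s : ℕ} (h : g ∈ D.orbitLE f s) :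
    D.d i • g ∈ D.orbitLE f (s + 1) := by
  obtain ⟨P, hP, rfl⟩ := mem_orbitLE.1 h
  exact mem_orbitLE.2 ⟨_, D.d_mul_mem_degreeLE i hP, mul_smul _ _ _⟩

theorem hilbertFunction_torsionOf (f : V) (s : ℕ) :
    D.hilbertFunction (Ideal.torsionOf D.OreAlgebra V f) s =
      Module.finrank K (D.orbitLE f s) :=
  D.hilbertFunction_eq_finrank_map _ _ (by ext; simp) s

/-- The action on `f` factors through the quotient by `I`, so the orbit is a linear image of a space
whose dimension is the Hilbert function. -/
theorem finrank_orbitLE_le {I : Ideal D.OreAlgebra} {f : V} (h : ∀ P ∈ I, P • f = 0) (s : ℕ) :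
    Module.finrank K (D.orbitLE f s) ≤ D.hilbertFunction I s := by
  let g : D.OreAlgebra →ₗ[K] D.OreAlgebra ⧸ I := (I.mkQ).restrictScalars K
  let l : D.OreAlgebra ⧸ I →ₗ[K] V :=
    (I.liftQ (LinearMap.toSpanSingleton D.OreAlgebra V f) fun P hP => h P hP).restrictScalars K
  have hg : LinearMap.ker g = I.restrictScalars K := by
    rw [LinearMap.ker_restrictScalars, Submodule.ker_mkQ]
  have hl : D.orbitLE f s = ((D.degreeLE s).map g).map l := by
    rw [← Submodule.map_comp]
    rfl
  rw [D.hilbertFunction_eq_finrank_map I g hg, hl]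
  exact Submodule.finrank_map_le _ _

theorem dim_torsionOf_d_smul_le {I : Ideal D.OreAlgebra} {f : V} (h : ∀ P ∈ I, P • f = 0)
    (i : Fin n) : D.dim (Ideal.torsionOf D.OreAlgebra V (D.d i • f)) ≤ D.dim I := by
  obtain ⟨P, hP⟩ := D.exists_isHilbertPolynomial I
  -- Since `Q (∂ᵢ f) = (Q ∂ᵢ) f`, the orbit in degree `s` is bounded by the Hilbert function at `s +
  -- 1`; the shift of `P` leaves its degree unchanged.
  rw [hP.dim_eq, ← degree_taylor P 1]
  refine IsHilbertPolynomial.dim_le ?_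
  filter_upwards [(Filter.tendsto_add_atTop_nat 1).eventually hP] with s hs
  rw [taylor_eval, ← Nat.cast_add_one, ← hs, Nat.cast_le, hilbertFunction_torsionOf]
  refine (Submodule.finrank_mono fun g hg => ?_).trans (finrank_orbitLE_le h (s + 1))
  obtain ⟨Q, hQ, rfl⟩ := mem_orbitLE.1 hg
  exact mem_orbitLE.2 ⟨_, D.mul_d_mem_degreeLE i hQ, mul_smul _ _ _⟩

theorem dim_torsionOf_add_le {I₁ I₂ : Ideal D.OreAlgebra} {f₁ f₂ : V}
    (h₁ : ∀ P ∈ I₁, P • f₁ = 0) (h₂ : ∀ P ∈ I₂, P • f₂ = 0) :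
    D.dim (Ideal.torsionOf D.OreAlgebra V (f₁ + f₂)) ≤ max (D.dim I₁) (D.dim I₂) := by
  obtain ⟨P₁, hP₁⟩ := D.exists_isHilbertPolynomial I₁
  obtain ⟨P₂, hP₂⟩ := D.exists_isHilbertPolynomial I₂
  rw [hP₁.dim_eq, hP₂.dim_eq]
  refine le_trans (IsHilbertPolynomial.dim_le ?_) (degree_add_le P₁ P₂)
  filter_upwards [hP₁, hP₂] with s hs₁ hs₂
  rw [eval_add, ← hs₁, ← hs₂, ← Nat.cast_add, Nat.cast_le, hilbertFunction_torsionOf]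
  have hle : D.orbitLE (f₁ + f₂) s ≤ D.orbitLE f₁ s ⊔ D.orbitLE f₂ s := fun g hg => by
    obtain ⟨Q, hQ, rfl⟩ := mem_orbitLE.1 hg
    rw [smul_add]
    exact Submodule.add_mem_sup (mem_orbitLE.2 ⟨Q, hQ, rfl⟩) (mem_orbitLE.2 ⟨Q, hQ, rfl⟩)
  exact (Submodule.finrank_mono hle).trans ((Submodule.finrank_add_le_finrank_add_finrank _ _).trans
    (add_le_add (finrank_orbitLE_le h₁ s) (finrank_orbitLE_le h₂ s)))

end

/-! ### Products in a linear extension. -/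

section

variable {C K A : Type*} [Field C] [Field K] [Algebra C K] {n : ℕ} {D : OreData C K n}
  [Ring A] [Algebra C A] [Algebra K A] [Module D.OreAlgebra A] {E : OreData C A n}

theorem IsLinearExtension.isScalarTower (hE : D.IsLinearExtension E) :
    IsScalarTower K D.OreAlgebra A :=
  ⟨fun c P a => by rw [smul_eq_coeff_mul, mul_smul, hE.coeff_smul, Algebra.smul_def]⟩

variable [IsScalarTower K D.OreAlgebra A]

/-- The image under `∂ᵢ` of a product of elements of two orbits. -/
theorem IsLinearExtension.d_smul_mem_mul_orbitLE (hE : D.IsLinearExtension E) (i : Fin n)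
    {f₁ f₂ g : A} {s : ℕ} (hg : g ∈ D.orbitLE f₁ s * D.orbitLE f₂ s) :
    D.d i • g ∈ D.orbitLE f₁ (s + 1) * D.orbitLE f₂ (s + 1) := by
  obtain ⟨u, v, hσ⟩ := hE.linear_σ i
  obtain ⟨u', v', hδ⟩ := hE.linear_δ i
  have hmem : ∀ (f : A) (a b : K) {x : A}, x ∈ D.orbitLE f s →
      a • (D.d i • x) + b • x ∈ D.orbitLE f (s + 1) := fun f a b x hx =>
    add_mem (Submodule.smul_mem _ _ (d_smul_mem_orbitLE i hx))
      (Submodule.smul_mem _ _ (orbitLE_mono f (Nat.le_succ s) hx))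
  induction hg using Submodule.mul_induction_on' with
  | mem_mul_mem x hx y hy =>
    -- Linearity of the extension turns `σᵢ x` and `δᵢ x` into combinations of `∂ᵢ x` and `x`, so
    -- they stay in the orbit of `f₁`, one degree higher.
    rw [hE.d_smul_mul, hσ, hδ]
    exact add_mem (Submodule.mul_mem_mul (hmem _ _ _ hx) (d_smul_mem_orbitLE i hy))
      (Submodule.mul_mem_mul (hmem _ _ _ hx) (orbitLE_mono _ (Nat.le_succ s) hy))
  | add x _ y _ hx hy => exact smul_add (D.d i) x y ▸ add_mem hx hy

theorem IsLinearExtension.orbitLE_mul_le (hE : D.IsLinearExtension E) (f₁ f₂ : A) (s : ℕ) :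
    D.orbitLE (f₁ * f₂) s ≤ D.orbitLE f₁ s * D.orbitLE f₂ s := by
  have hone : ∀ f : A, f ∈ D.orbitLE f 0 := fun f => mem_orbitLE.2
    ⟨1, Submodule.subset_span ⟨0, by simp, D.monomial_zero.symm⟩, one_smul _ f⟩
  have hmono : ∀ (t : ℕ) (α : Fin n → ℕ), ∑ i, α i = t →
      D.monomial α • (f₁ * f₂) ∈ D.orbitLE f₁ t * D.orbitLE f₂ t := by
    intro t
    induction t with
    | zero =>
      intro α hα
      have hα : α = 0 := by
        ext i
        simpa using Finset.sum_eq_zero_iff.1 hα i (Finset.mem_univ i)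
      rw [hα, monomial_zero, one_smul]
      exact Submodule.mul_mem_mul (hone f₁) (hone f₂)
    | succ t ih =>
      intro α hα
      obtain ⟨i, hi⟩ : ∃ i, α i ≠ 0 := by
        by_contra! h
        simp [h] at hα
      have hα' : Pi.single i 1 + (α - Pi.single i 1) = α := by
        refine add_tsub_cancel_of_le fun j => ?_
        rcases eq_or_ne j i with rfl | hj
        · simpa [Nat.one_le_iff_ne_zero] using hi
        · simp [hj]
      have hsum := sum_single_add i (α - Pi.single i 1)
      rw [hα', hα] at hsum
      rw [← hα', ← d_mul_monomial, mul_smul]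
      exact hE.d_smul_mem_mul_orbitLE i (ih _ (by omega))
  rw [orbitLE, degreeLE, Submodule.map_span, Submodule.span_le]
  rintro _ ⟨_, ⟨α, hα, rfl⟩, rfl⟩
  exact mul_le_mul' (orbitLE_mono f₁ hα) (orbitLE_mono f₂ hα) (hmono _ α rfl)

theorem IsLinearExtension.dim_torsionOf_mul_le (hE : D.IsLinearExtension E)
    {I₁ I₂ : Ideal D.OreAlgebra} {f₁ f₂ : A}
    (h₁ : ∀ P ∈ I₁, P • f₁ = 0) (h₂ : ∀ P ∈ I₂, P • f₂ = 0) :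
    D.dim (Ideal.torsionOf D.OreAlgebra A (f₁ * f₂)) ≤ D.dim I₁ + D.dim I₂ := by
  obtain ⟨P₁, hP₁⟩ := D.exists_isHilbertPolynomial I₁
  obtain ⟨P₂, hP₂⟩ := D.exists_isHilbertPolynomial I₂
  -- The bounding polynomial is `P₁ * P₂`; `degree_mul` also covers a zero factor, where both sides
  -- are `⊥`.
  rw [hP₁.dim_eq, hP₂.dim_eq, ← degree_mul]
  refine IsHilbertPolynomial.dim_le ?_
  filter_upwards [hP₁, hP₂] with s hs₁ hs₂
  rw [eval_mul, ← hs₁, ← hs₂, ← Nat.cast_mul, Nat.cast_le, hilbertFunction_torsionOf]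
  have hle := hE.orbitLE_mul_le f₁ f₂ s
  -- The product of two subspaces is the image of their tensor product, whose dimension is the
  -- product of theirs.
  rw [← Submodule.mulMap_range] at hle
  refine (Submodule.finrank_mono hle).trans ((LinearMap.finrank_range_le _).trans ?_)
  rw [Module.finrank_tensorProduct]
  exact Nat.mul_le_mul (finrank_orbitLE_le h₁ s) (finrank_orbitLE_le h₂ s)

end

end OreData

theorem mainTheorem2 {C : Type*} [Field C] [CharZero C] {m n : ℕ}
    (D : OreData C (RatFunField C m) n) :
    (∀ J : Ideal D.OreAlgebra, ∃ P : ℚ[X], D.IsHilbertPolynomial J P) ∧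
    ∀ I₁ I₂ : Ideal D.OreAlgebra,
      (∀ (M : Type*) [AddCommGroup M] [Module D.OreAlgebra M] (f₁ f₂ : M),
        (∀ P ∈ I₁, P • f₁ = 0) → (∀ P ∈ I₂, P • f₂ = 0) →
          (∀ i : Fin n, D.dim (Ideal.torsionOf D.OreAlgebra M (D.d i • f₁)) ≤ D.dim I₁) ∧
          D.dim (Ideal.torsionOf D.OreAlgebra M (f₁ + f₂)) ≤ max (D.dim I₁) (D.dim I₂)) ∧
      (∀ (A : Type*) [Ring A] [Algebra C A] [Algebra (RatFunField C m) A]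
        [IsScalarTower C (RatFunField C m) A] [Module D.OreAlgebra A] (E : OreData C A n),
        D.IsLinearExtension E → ∀ f₁ f₂ : A,
        (∀ P ∈ I₁, P • f₁ = 0) → (∀ P ∈ I₂, P • f₂ = 0) →
          D.dim (Ideal.torsionOf D.OreAlgebra A (f₁ * f₂)) ≤ D.dim I₁ + D.dim I₂) := by
  refine ⟨D.exists_isHilbertPolynomial, fun I₁ I₂ => ⟨?_, ?_⟩⟩
  · intro M _ _ f₁ f₂ h₁ h₂
    -- `M` becomes a vector space over the coefficient field through the embedding of the latter in
    -- the Ore algebra.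
    let _ : Module (RatFunField C m) M := Module.compHom M D.coeff
    have : IsScalarTower (RatFunField C m) D.OreAlgebra M :=
      ⟨fun c P x => mul_smul (D.coeff c) P x⟩
    exact ⟨OreData.dim_torsionOf_d_smul_le h₁, OreData.dim_torsionOf_add_le h₁ h₂⟩
  · intro A _ _ _ _ _ E hE f₁ f₂ h₁ h₂
    have := hE.isScalarTower
    exact hE.dim_torsionOf_mul_le h₁ h₂
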